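/- Let $n,m\ge 0$ be integers, let $A\in M_n(\mathbb R)$ and $B\in M_{n\times m}(\mathbb R)$, and suppose that the pair $(A,B)$ is controllable, i.e. $\operatorname{rank}[B, AB,\dots,A^{n-1}B]=n$. Let $\rho(M)$ denote the spectral radius of a real square matrix $M$, i.e. the largest modulus of a complex eigenvalue of $M$ (with $\rho=0$ for the empty matrix). In $M_{m\times n}(\mathbb R)$ with its usual (Euclidean) topology put $$\mathcal S_s=\{K\in M_{m\times n}(\mathbb R):\rho(A-BK)<1\},\qquad \mathcal B_s=\{K\in M_{m\times n}(\mathbb R):\rho(A-BK)=1\}.$$ Then the topological boundary of $\mathcal S_s$ is $\partial\mathcal S_s=\mathcal B_s$, and $\mathcal S_s$ is regular open, i.e. $\mathcal S_s$ is open and the interior of its closure is $\mathcal S_s$ itself. -/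

import Mathlib

namespace SchurStabilizing

/-- The spectral radius `ρ(M)` of a real square matrix: the largest modulus of a complex eigenvalue
of `M` (it is `0` for the empty matrix). -/
noncomputable def rho {n : ℕ} (M : Matrix (Fin n) (Fin n) ℝ) : ENNReal :=
  spectralRadius ℂ (M.map ((↑) : ℝ → ℂ))

/-- The matrix `M` is Schur stable: `ρ(M) < 1`. -/
def IsSchurStable {n : ℕ} (M : Matrix (Fin n) (Fin n) ℝ) : Prop :=
  rho M < 1

/-- The `n × (n m)` Kalman matrix `[B, A B, …, A ^ (n - 1) B]`; the column `(k, j)` is the column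
`j` of the block `A ^ k B`. -/
def kalmanMatrix {n m : ℕ} (A : Matrix (Fin n) (Fin n) ℝ) (B : Matrix (Fin n) (Fin m) ℝ) :
    Matrix (Fin n) (Fin n × Fin m) ℝ :=
  Matrix.of fun i p => (A ^ (p.1 : ℕ) * B) i p.2

/-- Controllability of `(A, B)` in the form of the Kalman rank condition. -/
def IsControllable {n m : ℕ} (A : Matrix (Fin n) (Fin n) ℝ) (B : Matrix (Fin n) (Fin m) ℝ) :
    Prop :=
  (kalmanMatrix A B).rank = n

/-- The set `S_s` of Schur stabilizing state-feedback gains. -/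
def stabilizingGains {n m : ℕ} (A : Matrix (Fin n) (Fin n) ℝ) (B : Matrix (Fin n) (Fin m) ℝ) :
    Set (Matrix (Fin m) (Fin n) ℝ) :=
  {K | IsSchurStable (A - B * K)}

/-- The set `B_s` of the gains `K` with `ρ(A - B K) = 1`. -/
def marginalGains {n m : ℕ} (A : Matrix (Fin n) (Fin n) ℝ) (B : Matrix (Fin n) (Fin m) ℝ) :
    Set (Matrix (Fin m) (Fin n) ℝ) :=
  {K | rho (A - B * K) = 1}

/-- A set is regular open if it is open and equal to the interior of its closure. -/
def IsRegularOpen {X : Type*} [TopologicalSpace X] (S : Set X) : Prop :=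
  IsOpen S ∧ interior (closure S) = S

end SchurStabilizing

/-!
The spectral radius `rho` is upper semicontinuous at the level `1` (`isOpen_setOf_isSchurStable`, by
compactness of the unit disc), so the set of stabilizing gains is open; it is also lower
semicontinuous there (`closure_setOf_isSchurStable_subset`, by a lower bound for the characteristic
polynomial outside the disc), so that `rho (A - B K) ≤ 1` on its closure. Both remaining claims
amount to one statement: every gain `K` with `rho (A - B K) = 1` is a limit of gains with
`rho (A - B K) < 1`, and also of gains with `rho (A - B K) > 1`.

Only a weak form of pole placement is needed for that. Let `w` be a left eigenvector of
`M = A - B K` for an eigenvalue `z` on the unit circle. Controllability gives the Hautus condition,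
which is not affected by feedback, and so some column `b` of `B` has `w ⬝ᵥ b ≠ 0`. The real rank one
matrix `b ⊗ (c w + conj (c w))` comes from a feedback, and adding it to `M` only affects the
eigenvalues `z` and `conj z`, with an explicit effect on the characteristic polynomial
(`charpoly_add_vecMulVec`). A suitable `c` moves them to `r z` and `r (conj z)` (for real `z`, one
copy of `z` to `r z`), and `c` tends to zero as `r` tends to `1` (`IsHautus.exists_feedback`). Taking
`r > 1` gives gains with `rho (A - B K) > 1`. Taking `r < 1` lowers the number of eigenvalues on the
unit circle, counted with multiplicity, without leaving the closed disc; an induction on this number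
gives stabilizing gains arbitrarily close to `K`.
-/

open Filter Topology Polynomial Matrix
open scoped ComplexConjugate

namespace SchurStabilizing

/-! ### The spectral radius and the complex eigenvalues -/

/-- The complex eigenvalues of a real matrix, counted with algebraic multiplicity: the roots of its
characteristic polynomial over `ℂ`. -/
noncomputable def eigs {n : ℕ} (M : Matrix (Fin n) (Fin n) ℝ) : Multiset ℂ :=
  (M.map ((↑) : ℝ → ℂ)).charpoly.roots

lemma mem_eigs_iff_mem_spectrum {n : ℕ} (M : Matrix (Fin n) (Fin n) ℝ) (z : ℂ) :
    z ∈ eigs M ↔ z ∈ spectrum ℂ (M.map ((↑) : ℝ → ℂ)) := by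
  rw [eigs, Matrix.mem_spectrum_iff_isRoot_charpoly,
    mem_roots (Matrix.charpoly_monic _).ne_zero]

lemma mem_eigs_iff_det {n : ℕ} (M : Matrix (Fin n) (Fin n) ℝ) (z : ℂ) :
    z ∈ eigs M ↔ (Matrix.scalar (Fin n) z - M.map ((↑) : ℝ → ℂ)).det = 0 := by
  rw [eigs, mem_roots (Matrix.charpoly_monic _).ne_zero, IsRoot.def, Matrix.eval_charpoly]

lemma rho_le_one_iff {n : ℕ} (M : Matrix (Fin n) (Fin n) ℝ) :
    rho M ≤ 1 ↔ ∀ z ∈ eigs M, ‖z‖ ≤ 1 := by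
  rw [rho, spectralRadius, iSup₂_le_iff]
  refine forall_congr' fun z => ?_
  rw [← mem_eigs_iff_mem_spectrum]
  refine imp_congr_right fun _ => ?_
  rw [← ENNReal.coe_one, ENNReal.coe_le_coe, ← NNReal.coe_le_coe, coe_nnnorm, NNReal.coe_one]

lemma rho_lt_one_iff {n : ℕ} (M : Matrix (Fin n) (Fin n) ℝ) :
    rho M < 1 ↔ ∀ z ∈ eigs M, ‖z‖ < 1 := by
  -- the spectrum is finite, so the supremum is a finite one
  have h : rho M = (eigs M).toFinset.sup fun z => (‖z‖₊ : ENNReal) := by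
    rw [rho, spectralRadius, Finset.sup_eq_iSup]
    simp only [Multiset.mem_toFinset, mem_eigs_iff_mem_spectrum]
  rw [h, Finset.sup_lt_iff (by simp)]
  simp only [Multiset.mem_toFinset]
  refine forall₂_congr fun z _ => ?_
  rw [← ENNReal.coe_one, ENNReal.coe_lt_coe, ← NNReal.coe_lt_coe, coe_nnnorm, NNReal.coe_one]

/-! ### Semicontinuity of the spectral radius at the level one -/

/-- Schur stability says that `det (1 - z M)` has no zero `z` in the closed unit disc. As the disc
is compact, this is an open condition. -/
lemma isOpen_setOf_isSchurStable (n : ℕ) :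
    IsOpen {M : Matrix (Fin n) (Fin n) ℝ | IsSchurStable M} := by
  have key : ∀ M : Matrix (Fin n) (Fin n) ℝ, IsSchurStable M ↔
      ∀ z ∈ Metric.closedBall (0 : ℂ) 1, (1 - z • M.map ((↑) : ℝ → ℂ)).det ≠ 0 := by
    intro M
    have hdet : ∀ z : ℂ, z ≠ 0 →
        ((1 - z • M.map ((↑) : ℝ → ℂ)).det = 0 ↔ z⁻¹ ∈ eigs M) := by
      intro z hz
      have : 1 - z • M.map ((↑) : ℝ → ℂ) =
          z • (Matrix.scalar (Fin n) z⁻¹ - M.map ((↑) : ℝ → ℂ)) := by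
        rw [smul_sub, Matrix.scalar_apply, ← Matrix.smul_one_eq_diagonal, smul_smul,
          mul_inv_cancel₀ hz, one_smul]
      rw [mem_eigs_iff_det, this, Matrix.det_smul]
      simp [hz]
    rw [IsSchurStable, rho_lt_one_iff]
    constructor
    · intro h z hz h0
      rw [mem_closedBall_zero_iff] at hz
      rcases eq_or_ne z 0 with rfl | hz0
      · simp at h0
      · have := h _ ((hdet z hz0).1 h0)
        rw [norm_inv] at this
        exact absurd (one_le_inv_iff₀.2 ⟨norm_pos_iff.2 hz0, hz⟩) (not_le.2 this)
    · intro h z hz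
      by_contra! hlt
      have hz0 : z ≠ 0 := by
        rintro rfl
        norm_num at hlt
      refine h z⁻¹ ?_ ((hdet _ (inv_ne_zero hz0)).2 (by rwa [inv_inv]))
      rw [mem_closedBall_zero_iff, norm_inv]
      exact inv_le_one_of_one_le₀ hlt
  have hc : Continuous fun p : Matrix (Fin n) (Fin n) ℝ × ℂ =>
      (1 - p.2 • p.1.map ((↑) : ℝ → ℂ)).det := by
    refine Continuous.matrix_det (continuous_const.sub (continuous_snd.smul ?_))
    exact continuous_fst.matrix_map Complex.continuous_ofReal
  refine isOpen_iff_mem_nhds.2 fun M hM => ?_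
  simp only [Set.mem_ofPred_eq, key] at hM ⊢
  exact (isCompact_closedBall (0 : ℂ) 1).eventually_forall_of_forall_eventually fun z hz =>
    hc.continuousAt.eventually_ne (hM z hz)

lemma pow_card_le_norm_prod_sub {z : ℂ} (hz : 1 ≤ ‖z‖) {s : Multiset ℂ}
    (hs : ∀ a ∈ s, ‖a‖ < 1) : (‖z‖ - 1) ^ s.card ≤ ‖(s.map fun a => z - a).prod‖ := by
  induction s using Multiset.induction with
  | empty => simp
  | cons a s ih =>
    rw [Multiset.card_cons, Multiset.map_cons, Multiset.prod_cons, norm_mul, pow_succ']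
    have ha := hs a (Multiset.mem_cons_self a s)
    have h1 : ‖z‖ - 1 ≤ ‖z - a‖ := by linarith [norm_sub_norm_le z a]
    exact mul_le_mul h1 (ih fun b hb => hs b (Multiset.mem_cons_of_mem hb))
      (pow_nonneg (by linarith) _) (norm_nonneg _)

/-- If all roots `zᵢ` of the characteristic polynomial lie in the unit disc and `1 < |z|`, then
`|χ(z)| = ∏ |z - zᵢ| ≥ (|z| - 1) ^ n`. This bound survives limits, so `z` is not an eigenvalue of a
limit of Schur stable matrices. -/
lemma closure_setOf_isSchurStable_subset (n : ℕ) :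
    closure {M : Matrix (Fin n) (Fin n) ℝ | IsSchurStable M} ⊆ {M | rho M ≤ 1} := by
  intro M hM
  rw [Set.mem_ofPred_eq, rho_le_one_iff]
  intro z hz
  by_contra! hlt
  have hsub : {M : Matrix (Fin n) (Fin n) ℝ | IsSchurStable M} ⊆
      {M | (‖z‖ - 1) ^ n ≤ ‖(Matrix.scalar (Fin n) z - M.map ((↑) : ℝ → ℂ)).det‖} := by
    intro N hN
    rw [Set.mem_ofPred_eq, IsSchurStable, rho_lt_one_iff] at hN
    have hsp := IsAlgClosed.splits (N.map ((↑) : ℝ → ℂ)).charpoly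
    have hcard : (eigs N).card = n := by
      rw [eigs, ← hsp.natDegree_eq_card_roots, Matrix.charpoly_natDegree_eq_dim, Fintype.card_fin]
    rw [Set.mem_ofPred_eq, ← Matrix.eval_charpoly,
      hsp.eval_eq_prod_roots_of_monic (Matrix.charpoly_monic _)]
    change _ ≤ ‖((eigs N).map fun a => z - a).prod‖
    simpa only [hcard] using pow_card_le_norm_prod_sub hlt.le hN
  have hcl : IsClosed {M : Matrix (Fin n) (Fin n) ℝ |
      (‖z‖ - 1) ^ n ≤ ‖(Matrix.scalar (Fin n) z - M.map ((↑) : ℝ → ℂ)).det‖} := by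
    refine isClosed_le continuous_const (Continuous.norm (Continuous.matrix_det ?_))
    exact continuous_const.sub (continuous_id.matrix_map Complex.continuous_ofReal)
  have hle := closure_minimal hsub hcl hM
  rw [Set.mem_ofPred_eq, (mem_eigs_iff_det M z).1 hz, norm_zero] at hle
  exact absurd hle (not_le.2 (pow_pos (by linarith) n))

/-! ### The Hautus condition -/

/-- The Hautus condition on `(M, B)`: no complex left eigenvector of `M` is annihilated by `B`. -/
def IsHautus {n m : ℕ} (M : Matrix (Fin n) (Fin n) ℝ) (B : Matrix (Fin n) (Fin m) ℝ) : Prop :=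
  ∀ (z : ℂ) (w : Fin n → ℂ), w ᵥ* M.map ((↑) : ℝ → ℂ) = z • w → w ᵥ* B.map ((↑) : ℝ → ℂ) = 0 →
    w = 0

lemma map_ofReal_mul {l m n : ℕ} (M : Matrix (Fin l) (Fin m) ℝ) (N : Matrix (Fin m) (Fin n) ℝ) :
    (M * N).map ((↑) : ℝ → ℂ) = M.map ((↑) : ℝ → ℂ) * N.map ((↑) : ℝ → ℂ) :=
  Matrix.map_mul (f := Complex.ofRealHom)

lemma map_ofReal_sub {m n : ℕ} (M N : Matrix (Fin m) (Fin n) ℝ) :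
    (M - N).map ((↑) : ℝ → ℂ) = M.map ((↑) : ℝ → ℂ) - N.map ((↑) : ℝ → ℂ) := by
  ext i j
  simp

lemma IsControllable.isHautus {n m : ℕ} {A : Matrix (Fin n) (Fin n) ℝ}
    {B : Matrix (Fin n) (Fin m) ℝ} (h : IsControllable A B) : IsHautus A B := by
  intro z w hA hB
  have hpow : ∀ k : ℕ, w ᵥ* (A ^ k * B).map ((↑) : ℝ → ℂ) = 0 := by
    intro k
    induction k with
    | zero => simpa using hB
    | succ k ih =>
      rw [pow_succ', Matrix.mul_assoc, map_ofReal_mul, ← Matrix.vecMul_vecMul, hA,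
        Matrix.smul_vecMul, ih, smul_zero]
  -- full row rank of the Kalman matrix
  have hinj : Function.Injective (kalmanMatrix A B).vecMul := by
    rw [Matrix.vecMul_injective_iff, linearIndependent_iff_card_eq_finrank_span, Set.finrank,
      ← Matrix.rank_eq_finrank_span_row, h, Fintype.card_fin]
  have hw : ∀ p, ∑ i, w i * ((kalmanMatrix A B i p : ℝ) : ℂ) = 0 := fun p =>
    congrFun (hpow p.1) p.2
  have hre : (fun i => (w i).re) = 0 := by
    refine hinj ?_
    funext p
    have := congrArg Complex.re (hw p)
    simpa [Matrix.vecMul, dotProduct] using this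
  have him : (fun i => (w i).im) = 0 := by
    refine hinj ?_
    funext p
    have := congrArg Complex.im (hw p)
    simpa [Matrix.vecMul, dotProduct] using this
  funext i
  exact Complex.ext (congrFun hre i) (congrFun him i)

lemma IsHautus.sub_mul {n m : ℕ} {A : Matrix (Fin n) (Fin n) ℝ} {B : Matrix (Fin n) (Fin m) ℝ}
    (h : IsHautus A B) (K : Matrix (Fin m) (Fin n) ℝ) : IsHautus (A - B * K) B := by
  intro z w hA hB
  refine h z w ?_ hB
  rwa [map_ofReal_sub, map_ofReal_mul, Matrix.vecMul_sub, ← Matrix.vecMul_vecMul, hB,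
    Matrix.zero_vecMul, sub_zero] at hA

/-! ### Moving one pair of eigenvalues by a small feedback -/

/-- A rank one perturbation in the direction of two left eigenvectors. For `s ≠ z₁, z₂` one has
`s - M - b ⊗ (w₁ + w₂) = (1 - b ⊗ (w₁ / (s - z₁) + w₂ / (s - z₂))) (s - M)`. -/
lemma charpoly_add_vecMulVec {n : ℕ} (M : Matrix (Fin n) (Fin n) ℂ) (b w₁ w₂ : Fin n → ℂ)
    (z₁ z₂ : ℂ) (h₁ : w₁ ᵥ* M = z₁ • w₁) (h₂ : w₂ ᵥ* M = z₂ • w₂) :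
    (X - C z₁) * (X - C z₂) * (M + vecMulVec b (w₁ + w₂)).charpoly =
      M.charpoly * ((X - C z₁) * (X - C z₂) - C (w₁ ⬝ᵥ b) * (X - C z₂) -
        C (w₂ ⬝ᵥ b) * (X - C z₁)) := by
  refine eq_of_infinite_eval_eq _ _ (Set.Infinite.mono (s := ({z₁, z₂} : Set ℂ)ᶜ) ?_
    (Set.Finite.infinite_compl (by simp)))
  intro s hs
  simp only [Set.mem_compl_iff, Set.mem_insert_iff, Set.mem_singleton_iff, not_or] at hs
  have hs₁ : s - z₁ ≠ 0 := sub_ne_zero.2 hs.1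
  have hs₂ : s - z₂ ≠ 0 := sub_ne_zero.2 hs.2
  set v : Fin n → ℂ := (s - z₁)⁻¹ • w₁ + (s - z₂)⁻¹ • w₂ with hv
  have hvM : v ᵥ* (Matrix.scalar (Fin n) s - M) = w₁ + w₂ := by
    have hsc : ∀ w : Fin n → ℂ, w ᵥ* Matrix.scalar (Fin n) s = s • w := by
      intro w
      rw [Matrix.scalar_apply, ← Matrix.smul_one_eq_diagonal, Matrix.vecMul_smul,
        Matrix.vecMul_one]
    rw [hv, Matrix.add_vecMul, Matrix.smul_vecMul, Matrix.smul_vecMul, Matrix.vecMul_sub,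
      Matrix.vecMul_sub, hsc, hsc, h₁, h₂, ← sub_smul, ← sub_smul, smul_smul, smul_smul,
      inv_mul_cancel₀ hs₁, inv_mul_cancel₀ hs₂, one_smul, one_smul]
  have hfac : Matrix.scalar (Fin n) s - (M + vecMulVec b (w₁ + w₂)) =
      (1 - vecMulVec b v) * (Matrix.scalar (Fin n) s - M) := by
    rw [Matrix.sub_mul, Matrix.one_mul, Matrix.vecMulVec_mul, hvM, sub_sub]
  have hdet : (1 - vecMulVec b v).det = 1 - v ⬝ᵥ b := by
    have := Matrix.det_one_add_replicateCol_mul_replicateRow (ι := Unit) (-b) v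
    rw [← Matrix.vecMulVec_eq, Matrix.neg_vecMulVec, ← sub_eq_add_neg, dotProduct_neg,
      ← sub_eq_add_neg] at this
    exact this
  simp only [Set.mem_ofPred_eq, eval_mul, eval_sub, eval_X, eval_C, Matrix.eval_charpoly]
  rw [hfac, Matrix.det_mul, hdet, hv, add_dotProduct, smul_dotProduct, smul_dotProduct,
    smul_eq_mul, smul_eq_mul]
  field_simp
  ring

/-- The coefficient of the perturbation that moves the pair `z, z̄`. For real `z` the perturbation
acts through twice the real part of the coefficient, and moves only one copy of `z`. -/
lemma exists_pole_shift (z : ℂ) :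
    ∃ a : ℝ → ℂ, Continuous a ∧ a 1 = 0 ∧ ∀ r : ℝ, ∃ μ : ℂ, (μ = z ∨ μ = r * conj z) ∧
      (X - C z) * (X - C (conj z)) - C (a r) * (X - C (conj z)) - C (conj (a r)) * (X - C z) =
        (X - C (r * z)) * (X - C μ) := by
  by_cases hz : conj z = z
  · refine ⟨fun r => (r - 1) * z / 2, by fun_prop, by simp, fun r => ⟨z, Or.inl rfl, ?_⟩⟩
    refine Polynomial.funext fun s => ?_
    simp only [eval_mul, eval_sub, eval_X, eval_C, map_mul, map_sub, map_div₀, Complex.conj_ofReal,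
      map_one, map_ofNat, hz]
    ring
  -- the two values are the residues of the partial fraction decomposition of
  -- `(s - r z) (s - r z̄) / ((s - z) (s - z̄))`, up to sign
  · refine ⟨fun r => (r - 1) * z * (z - r * conj z) / (z - conj z), by fun_prop, by simp,
      fun r => ⟨r * conj z, Or.inr rfl, ?_⟩⟩
    refine Polynomial.funext fun s => ?_
    simp only [eval_mul, eval_sub, eval_X, eval_C, map_mul, map_sub, map_div₀, Complex.conj_ofReal,
      map_one, Complex.conj_conj]
    have h₁ : z - conj z ≠ 0 := sub_ne_zero.2 (Ne.symm hz)
    have h₂ : conj z - z ≠ 0 := sub_ne_zero.2 hz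
    rw [← neg_sub z (conj z), div_neg]
    field_simp
    ring

/-- An eigenvalue `z` of a pair satisfying the Hautus condition, together with its conjugate, can be
moved to `r z` and `r z̄` (only one copy of a real `z` is moved) by a feedback that tends to zero as
`r` tends to one, all other eigenvalues being kept. -/
lemma IsHautus.exists_feedback {n m : ℕ} {M : Matrix (Fin n) (Fin n) ℝ}
    {B : Matrix (Fin n) (Fin m) ℝ} (h : IsHautus M B) {z : ℂ} (hz : z ∈ eigs M) :
    ∃ L : ℝ → Matrix (Fin m) (Fin n) ℝ, Tendsto L (𝓝 1) (𝓝 0) ∧ ∀ r : ℝ, ∃ μ : ℂ,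
      (μ = z ∨ μ = r * conj z) ∧
      {z, conj z} + eigs (M - B * L r) = eigs M + {(r * z : ℂ), μ} := by
  obtain ⟨w, hw0, hw⟩ := Matrix.exists_vecMul_eq_zero_iff.2 ((mem_eigs_iff_det M z).1 hz)
  have hwz : w ᵥ* M.map ((↑) : ℝ → ℂ) = z • w := by
    rw [Matrix.vecMul_sub, Matrix.scalar_apply, ← Matrix.smul_one_eq_diagonal, Matrix.vecMul_smul,
      Matrix.vecMul_one, sub_eq_zero] at hw
    exact hw.symm
  obtain ⟨j, hj⟩ : ∃ j, (w ᵥ* B.map ((↑) : ℝ → ℂ)) j ≠ 0 := by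
    by_contra! hB
    exact hw0 (h z w hwz (funext hB))
  set b : Fin n → ℂ := fun i => (B i j : ℂ) with hb
  have hβ : w ⬝ᵥ b ≠ 0 := hj
  obtain ⟨a, hac, ha1, ha⟩ := exists_pole_shift z
  set c : ℝ → ℂ := fun r => a r / (w ⬝ᵥ b) with hc
  have hcc : Continuous c := hac.div_const _
  -- the row `2 Re (c w) = c w + conj (c w)`, fed to the input `j`
  set L : ℝ → Matrix (Fin m) (Fin n) ℝ := fun r =>
    vecMulVec (Pi.single j 1) fun i => -(2 * (c r * w i).re) with hL
  refine ⟨L, ?_, fun r => ?_⟩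
  · have hLc : Continuous L := by
      refine Continuous.matrix_vecMulVec continuous_const ?_
      fun_prop
    have hL1 : L 1 = 0 := by
      ext i k
      simp [hL, hc, ha1, Matrix.vecMulVec_apply]
    exact hL1 ▸ hLc.tendsto 1
  · obtain ⟨μ, hμ, hpoly⟩ := ha r
    refine ⟨μ, hμ, ?_⟩
    have hmap : (M - B * L r).map ((↑) : ℝ → ℂ) =
        M.map ((↑) : ℝ → ℂ) + vecMulVec b (c r • w + star (c r • w)) := by
      ext i k
      simp only [hL, Matrix.mul_vecMulVec, Matrix.map_apply, Matrix.sub_apply, Matrix.add_apply,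
        Matrix.vecMulVec_apply, Matrix.mulVec_single_one, Matrix.col_apply, Pi.add_apply,
        Pi.smul_apply, Pi.star_apply, smul_eq_mul, hb]
      rw [← starRingEnd_apply, Complex.add_conj]
      push_cast
      ring
    have hw₁ : (c r • w) ᵥ* M.map ((↑) : ℝ → ℂ) = z • (c r • w) := by
      rw [Matrix.smul_vecMul, hwz, smul_comm]
    have hstar : ∀ (v : Fin n → ℂ), star v ᵥ* M.map ((↑) : ℝ → ℂ) =
        star (v ᵥ* M.map ((↑) : ℝ → ℂ)) := by
      intro v
      funext k
      simp [Matrix.vecMul, dotProduct]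
    have hw₂ : star (c r • w) ᵥ* M.map ((↑) : ℝ → ℂ) = conj z • star (c r • w) := by
      rw [hstar, hw₁, star_smul, starRingEnd_apply]
    have hd₁ : (c r • w) ⬝ᵥ b = a r := by
      rw [smul_dotProduct, smul_eq_mul, hc, div_mul_cancel₀ _ hβ]
    have hd₂ : star (c r • w) ⬝ᵥ b = conj (a r) := by
      rw [← hd₁]
      simp [dotProduct, hb]
    have hchar := charpoly_add_vecMulVec _ b _ _ z (conj z) hw₁ hw₂
    rw [← hmap, hd₁, hd₂, hpoly] at hchar
    have hroots := congrArg roots hchar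
    have hX : ∀ u : ℂ, (X - C u) ≠ 0 := X_sub_C_ne_zero
    have hM : ∀ N : Matrix (Fin n) (Fin n) ℂ, N.charpoly ≠ 0 := fun N =>
      (Matrix.charpoly_monic N).ne_zero
    rw [roots_mul (mul_ne_zero (mul_ne_zero (hX _) (hX _)) (hM _)), roots_mul
      (mul_ne_zero (hX _) (hX _)), roots_mul (mul_ne_zero (hM _) (mul_ne_zero (hX _) (hX _))),
      roots_mul (mul_ne_zero (hX _) (hX _))] at hroots
    simpa only [eigs, roots_X_sub_C, Multiset.singleton_add, Multiset.insert_eq_cons] using hroots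

/-! ### Marginal gains -/

section MarginalGains

variable {n m : ℕ} {A : Matrix (Fin n) (Fin n) ℝ} {B : Matrix (Fin n) (Fin m) ℝ}

lemma sub_mul_add (K L : Matrix (Fin m) (Fin n) ℝ) : A - B * (K + L) = A - B * K - B * L := by
  rw [Matrix.mul_add, sub_sub]

/-- Induction on the number of eigenvalues on the unit circle: pulling one such eigenvalue and its
conjugate into the open disc by an arbitrarily small feedback lowers this number. -/
lemma IsHautus.mem_closure_stabilizingGains (h : IsHautus A B) (K : Matrix (Fin m) (Fin n) ℝ)
    (hK : rho (A - B * K) ≤ 1) : K ∈ closure (stabilizingGains A B) := by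
  classical
  obtain ⟨N, hN⟩ : ∃ N, (eigs (A - B * K)).countP (fun z => ‖z‖ = 1) ≤ N := ⟨_, le_rfl⟩
  induction N generalizing K with
  | zero =>
    refine subset_closure ((rho_lt_one_iff _).2 fun z hz => ?_)
    rw [Nat.le_zero, Multiset.countP_eq_zero] at hN
    exact lt_of_le_of_ne ((rho_le_one_iff _).1 hK z hz) (hN z hz)
  | succ N ih =>
    rw [rho_le_one_iff] at hK
    by_cases hS : K ∈ stabilizingGains A B
    · exact subset_closure hS
    obtain ⟨z, hz, hz1⟩ : ∃ z ∈ eigs (A - B * K), ‖z‖ = 1 := by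
      have : ¬ rho (A - B * K) < 1 := hS
      rw [rho_lt_one_iff] at this
      push Not at this
      obtain ⟨z, hz, hle⟩ := this
      exact ⟨z, hz, le_antisymm (hK z hz) hle⟩
    obtain ⟨L, hL, hLr⟩ := (h.sub_mul K).exists_feedback hz
    have hlim : Tendsto (fun r => K + L r) (𝓝[<] 1) (𝓝 K) := by
      simpa using (hL.mono_left nhdsWithin_le_nhds).const_add K
    rw [← closure_closure]
    refine mem_closure_of_tendsto hlim ?_
    filter_upwards [Ioo_mem_nhdsLT (zero_lt_one' ℝ)] with r hr
    obtain ⟨μ, hμ, heq⟩ := hLr r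
    have hrz : ‖(r * z : ℂ)‖ = r := by
      rw [norm_mul, Complex.norm_real, Real.norm_of_nonneg hr.1.le, hz1, mul_one]
    have hμ1 : ‖μ‖ ≤ 1 := by
      rcases hμ with rfl | rfl
      · exact hz1.le
      · rw [norm_mul, Complex.norm_conj, hz1, mul_one, Complex.norm_real,
          Real.norm_of_nonneg hr.1.le]
        exact hr.2.le
    refine ih _ ?_ ?_
    · rw [rho_le_one_iff, sub_mul_add]
      intro y hy
      have hmem := Multiset.mem_add.2 (Or.inr hy : y ∈ ({z, conj z} : Multiset ℂ) ∨ _)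
      rw [heq, Multiset.mem_add] at hmem
      rcases hmem with hmem | hmem
      · exact hK y hmem
      · simp only [Multiset.insert_eq_cons, Multiset.mem_cons, Multiset.mem_singleton] at hmem
        rcases hmem with rfl | rfl
        · exact hrz.trans_le hr.2.le
        · exact hμ1
    · have hcount := congrArg (Multiset.countP fun z : ℂ => ‖z‖ = 1) heq
      -- `z` and `conj z` are replaced by `r z`, off the circle, and `μ`, which may be on it
      have hr1 : r ≠ 1 := hr.2.ne
      simp only [Multiset.insert_eq_cons, Multiset.countP_add, ← Multiset.cons_zero,
        Multiset.countP_cons, Multiset.countP_zero, Complex.norm_conj, hz1, hrz, hr1, if_true,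
        if_false] at hcount
      rw [sub_mul_add]
      split_ifs at hcount <;> omega

/-- A unit circle eigenvalue can be pushed out of the closed disc by an arbitrarily small
feedback. -/
lemma IsHautus.mem_closure_one_lt_rho (h : IsHautus A B) (K : Matrix (Fin m) (Fin n) ℝ)
    (hK : rho (A - B * K) = 1) : K ∈ closure {K | 1 < rho (A - B * K)} := by
  obtain ⟨z, hz, hz1⟩ : ∃ z ∈ eigs (A - B * K), ‖z‖ = 1 := by
    have hlt : ¬ rho (A - B * K) < 1 := hK.not_lt
    rw [rho_lt_one_iff] at hlt
    push Not at hlt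
    obtain ⟨z, hz, hle⟩ := hlt
    exact ⟨z, hz, le_antisymm ((rho_le_one_iff _).1 hK.le z hz) hle⟩
  obtain ⟨L, hL, hLr⟩ := (h.sub_mul K).exists_feedback hz
  have hlim : Tendsto (fun r => K + L r) (𝓝[>] 1) (𝓝 K) := by
    simpa using (hL.mono_left nhdsWithin_le_nhds).const_add K
  refine mem_closure_of_tendsto hlim ?_
  filter_upwards [self_mem_nhdsWithin] with r hr
  have hr : 1 < r := hr
  obtain ⟨μ, -, heq⟩ := hLr r
  have hrz : ‖(r * z : ℂ)‖ = r := by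
    rw [norm_mul, Complex.norm_real, Real.norm_of_nonneg (by linarith), hz1, mul_one]
  have hmem : (r * z : ℂ) ∈ eigs (A - B * K) + {(r * z : ℂ), μ} := by simp
  rw [← heq, Multiset.mem_add] at hmem
  rw [← not_le, rho_le_one_iff, sub_mul_add]
  intro hle
  rcases hmem with hmem | hmem
  · simp only [Multiset.insert_eq_cons, Multiset.mem_cons, Multiset.mem_singleton] at hmem
    rcases hmem with hmem | hmem
    · rw [hmem, hz1] at hrz
      exact hr.ne hrz
    · rw [hmem, Complex.norm_conj, hz1] at hrz
      exact hr.ne hrz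
  · exact absurd (hle _ hmem) (by rw [hrz]; exact not_le.2 hr)

end MarginalGains

end SchurStabilizing

open SchurStabilizing in
theorem mainTheorem3 (n m : ℕ) (A : Matrix (Fin n) (Fin n) ℝ) (B : Matrix (Fin n) (Fin m) ℝ)
    (hAB : SchurStabilizing.IsControllable A B) :
    frontier (SchurStabilizing.stabilizingGains A B) = SchurStabilizing.marginalGains A B ∧
      SchurStabilizing.IsRegularOpen (SchurStabilizing.stabilizingGains A B) := by
  have hH := hAB.isHautus
  have hcont : Continuous fun K : Matrix (Fin m) (Fin n) ℝ => A - B * K := by fun_prop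
  have hopen : IsOpen (stabilizingGains A B) := (isOpen_setOf_isSchurStable n).preimage hcont
  have hle : ∀ K ∈ closure (stabilizingGains A B), rho (A - B * K) ≤ 1 := fun K hK =>
    closure_setOf_isSchurStable_subset n (hcont.closure_preimage_subset _ hK)
  refine ⟨?_, hopen, subset_antisymm (fun K hK => ?_) (interior_maximal subset_closure hopen)⟩
  · rw [hopen.frontier_eq]
    ext K
    constructor
    · rintro ⟨hcl, hn⟩
      exact le_antisymm (hle K hcl) (not_lt.1 hn)
    · intro hK
      have hK : rho (A - B * K) = 1 := hK
      exact ⟨hH.mem_closure_stabilizingGains K hK.le, hK.not_lt⟩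
    -- near a marginal gain there are gains outside the closure, so it is not an interior point
  · by_contra hn
    have hK1 : rho (A - B * K) = 1 := le_antisymm (hle K (interior_subset hK)) (not_lt.1 hn)
    obtain ⟨K', hint, hgt⟩ :=
      mem_closure_iff.1 (hH.mem_closure_one_lt_rho K hK1) _ isOpen_interior hK
    exact absurd (hle K' (interior_subset hint)) (not_le.2 hgt)
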